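/- Let $G$ be a totally disconnected, locally compact group. For a compact open subgroup $V\leqslant G$ and $x\in G$ put $s_V(x):=[xVx^{-1}:xVx^{-1}\cap V]$, a positive integer, and let the scale of $x$ be $$s(x):=\min\{s_V(x) : V\leqslant G,\ V \text{ compact and open}\}.$$ A compact open subgroup $V$ is minimizing for $x$ if $s_V(x)=s(x)$. A semigroup $\mathcal S\subseteq G$ is multiplicative over $V$ if $V\subseteq\mathcal S$ and $s_V(yz)=s_V(y)s_V(z)$ for all $y,z\in\mathcal S$. Proposition. Let $x\in G$ and let $V$ be a compact open subgroup of $G$ that is minimizing for $x$. Then the subsemigroup of $G$ generated by $x$ and $V$ is multiplicative over $V$. If, in addition, $s(x)\neq 1$, then this semigroup is not compact. -/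

import Mathlib

namespace TDLCGroup

/-- The conjugate subgroup `x V x⁻¹`. -/
def conjSubgroup {G : Type*} [Group G] (x : G) (V : Subgroup G) : Subgroup G :=
  V.map (MulAut.conj x).toMonoidHom

/-- The index `s_V(x) = [x V x⁻¹ : x V x⁻¹ ∩ V]`. -/
noncomputable def displacementIndex {G : Type*} [Group G] (V : Subgroup G) (x : G) : ℕ :=
  (conjSubgroup x V ⊓ V).relIndex (conjSubgroup x V)

/-- The index `s_V(x)` of a compact open subgroup is a positive integer, so the convention
that an infinite index has the value `0` plays no role. -/
theorem displacementIndex_pos {G : Type*} [Group G] [TopologicalSpace G] [IsTopologicalGroup G]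
    (V : Subgroup G) (hVo : IsOpen (V : Set G)) (hVc : IsCompact (V : Set G)) (x : G) :
    0 < displacementIndex V x := by
  have hcont : Continuous (MulAut.conj x) := by
    show Continuous fun g => x * g * x⁻¹
    fun_prop
  have hc : IsCompact (conjSubgroup x V : Set G) := by
    have h := hVc.image hcont
    simpa [conjSubgroup] using h
  haveI : CompactSpace (conjSubgroup x V) := isCompact_iff_compactSpace.mp hc
  have ho : IsOpen ((V.subgroupOf (conjSubgroup x V) : Subgroup (conjSubgroup x V)) :
      Set (conjSubgroup x V)) := hVo.preimage continuous_subtype_val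
  haveI : Finite (conjSubgroup x V ⧸ V.subgroupOf (conjSubgroup x V)) :=
    Subgroup.quotient_finite_of_isOpen _ ho
  unfold displacementIndex
  rw [Subgroup.inf_relIndex_left]
  exact Nat.pos_of_ne_zero (Subgroup.index_ne_zero_of_finite)

/-- The scale `s(x)`: the minimum of `[x V x⁻¹ : x V x⁻¹ ∩ V]` over all compact open
subgroups `V` of `G`. -/
noncomputable def scale {G : Type*} [Group G] [TopologicalSpace G] (x : G) : ℕ :=
  sInf {n : ℕ | ∃ V : Subgroup G,
    IsOpen (V : Set G) ∧ IsCompact (V : Set G) ∧ n = displacementIndex V x}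

/-- `V` is minimizing for `x`: it is a compact open subgroup at which the minimum defining
the scale of `x` is attained. -/
def IsMinimizing {G : Type*} [Group G] [TopologicalSpace G] (V : Subgroup G) (x : G) : Prop :=
  IsOpen (V : Set G) ∧ IsCompact (V : Set G) ∧ displacementIndex V x = scale x

/-- A semigroup `S ⊆ G` is multiplicative over the (compact open) subgroup `V` if it contains
`V` and `s_V` is multiplicative on `S`. -/
def IsMultiplicativeOver {G : Type*} [Group G] (S : Subsemigroup G) (V : Subgroup G) : Prop :=
  (V : Set G) ⊆ S ∧
    ∀ x ∈ S, ∀ y ∈ S,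
      displacementIndex V (x * y) = displacementIndex V x * displacementIndex V y

end TDLCGroup

namespace TDLCGroup

open scoped Topology Pointwise

/-! ### Index inequalities for the displacement $s_V$ and their equality cases. -/

section Index

variable {G : Type*} [Group G]

/-! Since $s_V(yz)=[zVz^{-1}: zVz^{-1}\cap y^{-1}Vy]$, passing through $V$ gives $s_V(yz)\le
s_V(y)s_V(z)$, and equality forces $yVz\subseteq VyzV$. So if $s_V(x^n)=s_V(x)^n$ for all $n$, the
semigroup lies in $\bigcup_n Vx^nV$; as $s_V$ is constant on double cosets of $V$, it is
multiplicative there. Non-compactness follows because $s_V$ is continuous and unbounded on the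
powers of $x$ when $s_V(x)\ne1$.

The power law for a minimizing $V$ comes by comparison with one compact open $W$ that satisfies it:
$s_W\le C s_V$ and $s_V(x)\le s_W(x)$ leave no room for a strict inequality
(`displacementIndex_pow_eq`).

Such a $W$ is Willis's tidy subgroup: $W=W_+W_-$, and $W$ contains every element whose $x$-orbit is
in $W$ for all but finitely many times. Finite intersections of conjugates achieve the first
condition. For the second, let $L$ be the closure of the group of elements with orbit almost in $V$;
it is compact and $x$-invariant. In $V'L$, with $V'$ small and normalized by $L$, all
almost-contained orbits lie in $L$, by a shadowing argument (`cofiniteCore_le_limitCore_of_forall`).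
-/

theorem exists_mul_eq_of_relIndex_eq {D K H : Subgroup G} (hKH : K ≤ H)
    (h0 : D.relIndex H ≠ 0) (h : D.relIndex K = D.relIndex H) :
    ∀ g ∈ H, ∃ k ∈ K, ∃ d ∈ D, k * d = g := by
  intro g hg
  have : Finite (H ⧸ D.subgroupOf H) := by
    by_contra hf
    exact h0 (Subgroup.index_eq_zero_iff_infinite.2 (not_finite_iff_infinite.1 hf))
  have hinj := (Subgroup.quotientSubgroupOfEmbeddingOfLE D hKH).injective
  have hb := hinj.bijective_of_nat_card_le (le_of_eq h.symm)
  obtain ⟨q, hq⟩ := hb.2 (QuotientGroup.mk ⟨g, hg⟩)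
  induction q using QuotientGroup.induction_on with
  | H k =>
    have hq' : (QuotientGroup.mk (Subgroup.inclusion hKH k) : H ⧸ D.subgroupOf H) =
      QuotientGroup.mk ⟨g, hg⟩ := hq
    rw [QuotientGroup.eq, Subgroup.mem_subgroupOf] at hq'
    exact ⟨k, k.2, _, hq', by simp⟩

theorem relIndex_eq_of_exists_mul_eq {D K H : Subgroup G} (hKH : K ≤ H)
    (h : ∀ g ∈ H, ∃ k ∈ K, ∃ d ∈ D, k * d = g) : D.relIndex K = D.relIndex H := by
  refine Nat.card_eq_of_bijective (Subgroup.quotientSubgroupOfEmbeddingOfLE D hKH)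
    ⟨(Subgroup.quotientSubgroupOfEmbeddingOfLE D hKH).injective, fun q => ?_⟩
  induction q using QuotientGroup.induction_on with
  | H g =>
    obtain ⟨k, hk, d, hd, hkd⟩ := h g g.2
    refine ⟨QuotientGroup.mk ⟨k, hk⟩, ?_⟩
    change (QuotientGroup.mk (Subgroup.inclusion hKH ⟨k, hk⟩) : H ⧸ D.subgroupOf H) = _
    rw [QuotientGroup.eq, Subgroup.mem_subgroupOf]
    simpa [← hkd] using hd

/-- $[C:C\cap D]\le[C:C\cap D\cap V]=[V\cap C:V\cap C\cap D]\,[C:C\cap V]$, and the first factor is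
at most $[V:V\cap D]$. -/
theorem relIndex_le_mul {D V C : Subgroup G} (hDV : D.relIndex V ≠ 0) (hVC : V.relIndex C ≠ 0) :
    D.relIndex C ≤ D.relIndex V * V.relIndex C := by
  have h1 : D.relIndex (V ⊓ C) ≤ D.relIndex V := Subgroup.relIndex_le_of_le_right inf_le_left hDV
  have h2 : D.relIndex (V ⊓ C) ≠ 0 := fun h => hDV (Subgroup.relIndex_eq_zero_of_le_right inf_le_left h)
  have h3 : D.relIndex C ≤ (D ⊓ V).relIndex C :=
    Subgroup.relIndex_le_of_le_left inf_le_left (by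
      rw [← Subgroup.relIndex_inf_mul_relIndex]; exact mul_ne_zero h2 hVC)
  rw [← Subgroup.relIndex_inf_mul_relIndex] at h3
  exact h3.trans (Nat.mul_le_mul_right _ h1)

/-- Equality in `relIndex_le_mul` makes the injection of cosets of $D$ from $V\cap C$ into $V$ a
bijection. -/
theorem exists_mul_eq_of_relIndex_eq_mul {D V C : Subgroup G} (hDV : D.relIndex V ≠ 0)
    (hVC : V.relIndex C ≠ 0) (h : D.relIndex C = D.relIndex V * V.relIndex C) :
    ∀ g ∈ V, ∃ k ∈ V ⊓ C, ∃ d ∈ D, k * d = g := by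
  refine exists_mul_eq_of_relIndex_eq inf_le_left hDV (le_antisymm ?_ ?_)
  · exact Subgroup.relIndex_le_of_le_right inf_le_left hDV
  · have h2 : D.relIndex (V ⊓ C) ≠ 0 :=
      fun h => hDV (Subgroup.relIndex_eq_zero_of_le_right inf_le_left h)
    have h3 : D.relIndex C ≤ (D ⊓ V).relIndex C :=
      Subgroup.relIndex_le_of_le_left inf_le_left (by
        rw [← Subgroup.relIndex_inf_mul_relIndex]; exact mul_ne_zero h2 hVC)
    rw [← Subgroup.relIndex_inf_mul_relIndex, h] at h3
    exact Nat.le_of_mul_le_mul_right h3 (Nat.pos_of_ne_zero hVC)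

theorem relIndex_eq_mul {D V C : Subgroup G} (hDC : D ⊓ C ≤ V)
    (h : ∀ g ∈ V, ∃ k ∈ V ⊓ C, ∃ d ∈ D, k * d = g) :
    D.relIndex C = D.relIndex V * V.relIndex C := by
  rw [← relIndex_eq_of_exists_mul_eq inf_le_left h, Subgroup.relIndex_inf_mul_relIndex,
    ← Subgroup.inf_relIndex_right D C, ← Subgroup.inf_relIndex_right (D ⊓ V) C]
  congr 1
  ext g
  simp only [Subgroup.mem_inf]
  exact ⟨fun hg => ⟨⟨hg.1, hDC hg⟩, hg.2⟩, fun hg => ⟨hg.1.1, hg.2⟩⟩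

theorem mem_conjSubgroup {x g : G} {V : Subgroup G} :
    g ∈ conjSubgroup x V ↔ x⁻¹ * g * x ∈ V := by
  constructor
  · rintro ⟨v, hv, rfl⟩
    simpa [mul_assoc] using hv
  · intro h
    exact ⟨_, h, by simp [mul_assoc]⟩

theorem conjSubgroup_mul (x y : G) (V : Subgroup G) :
    conjSubgroup (x * y) V = conjSubgroup x (conjSubgroup y V) := by
  ext g
  simp [mem_conjSubgroup, mul_assoc]

theorem conjSubgroup_of_mem {V : Subgroup G} {v : G} (hv : v ∈ V) : conjSubgroup v V = V := by
  ext g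
  rw [mem_conjSubgroup, V.mul_mem_cancel_right hv, V.mul_mem_cancel_left (V.inv_mem hv)]

theorem relIndex_conjSubgroup (x : G) (U V : Subgroup G) :
    (conjSubgroup x U).relIndex (conjSubgroup x V) = U.relIndex V :=
  Subgroup.relIndex_map_map_of_injective _ _ (MulAut.conj x).injective

theorem displacementIndex_eq (V : Subgroup G) (x : G) :
    displacementIndex V x = V.relIndex (conjSubgroup x V) :=
  Subgroup.inf_relIndex_left _ _

theorem displacementIndex_eq' (V : Subgroup G) (x : G) :
    displacementIndex V x = (conjSubgroup x⁻¹ V).relIndex V := by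
  rw [displacementIndex_eq, ← relIndex_conjSubgroup x⁻¹, ← conjSubgroup_mul, inv_mul_cancel,
    conjSubgroup_of_mem V.one_mem]

theorem displacementIndex_mul_eq_relIndex (V : Subgroup G) (y z : G) :
    displacementIndex V (y * z) = (conjSubgroup y⁻¹ V).relIndex (conjSubgroup z V) := by
  rw [displacementIndex_eq, ← relIndex_conjSubgroup y⁻¹, ← conjSubgroup_mul, inv_mul_cancel_left]

theorem displacementIndex_one (V : Subgroup G) : displacementIndex V 1 = 1 := by
  rw [displacementIndex_eq, conjSubgroup_of_mem V.one_mem, Subgroup.relIndex_self]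

theorem displacementIndex_mul_of_mem {V : Subgroup G} {v w : G} (hv : v ∈ V) (hw : w ∈ V) (x : G) :
    displacementIndex V (v * x * w) = displacementIndex V x := by
  rw [displacementIndex_eq, displacementIndex_eq, conjSubgroup_mul, conjSubgroup_of_mem hw,
    conjSubgroup_mul]
  simpa [conjSubgroup_of_mem hv] using relIndex_conjSubgroup v V (conjSubgroup x V)

end Index

/-! ### From the power law to multiplicativity and non-compactness. -/

section Topological

variable {G : Type*} [Group G] [TopologicalSpace G] [IsTopologicalGroup G]

theorem relIndex_ne_zero_of_isOpen_of_isCompact {U V : Subgroup G} (hU : IsOpen (U : Set G))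
    (hV : IsCompact (V : Set G)) : U.relIndex V ≠ 0 := by
  have : CompactSpace V := isCompact_iff_compactSpace.mp hV
  have ho : IsOpen (U.subgroupOf V : Set V) := hU.preimage continuous_subtype_val
  have : Finite (V ⧸ U.subgroupOf V) := Subgroup.quotient_finite_of_isOpen _ ho
  exact Subgroup.index_ne_zero_of_finite

theorem isCompact_conjSubgroup {V : Subgroup G} (hV : IsCompact (V : Set G)) (x : G) :
    IsCompact (conjSubgroup x V : Set G) := by
  have hcont : Continuous (MulAut.conj x) := by
    show Continuous fun g => x * g * x⁻¹
    fun_prop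
  simpa [conjSubgroup] using hV.image hcont

theorem isOpen_conjSubgroup {V : Subgroup G} (hV : IsOpen (V : Set G)) (x : G) :
    IsOpen (conjSubgroup x V : Set G) := by
  have h : (conjSubgroup x V : Set G) = (fun g => x⁻¹ * g * x) ⁻¹' V := by
    ext g
    exact mem_conjSubgroup
  rw [h]
  exact hV.preimage (by fun_prop)

theorem displacementIndex_mul_le {V : Subgroup G} (hVo : IsOpen (V : Set G))
    (hVc : IsCompact (V : Set G)) (y z : G) :
    displacementIndex V (y * z) ≤ displacementIndex V y * displacementIndex V z := by
  rw [displacementIndex_mul_eq_relIndex, displacementIndex_eq' V y, displacementIndex_eq V z]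
  exact relIndex_le_mul
    (relIndex_ne_zero_of_isOpen_of_isCompact (isOpen_conjSubgroup hVo _) hVc)
    (relIndex_ne_zero_of_isOpen_of_isCompact hVo (isCompact_conjSubgroup hVc _))

theorem displacementIndex_pow_le {V : Subgroup G} (hVo : IsOpen (V : Set G))
    (hVc : IsCompact (V : Set G)) (y : G) (n : ℕ) :
    displacementIndex V (y ^ n) ≤ displacementIndex V y ^ n := by
  induction n with
  | zero => simp [displacementIndex_one]
  | succ n ih =>
    rw [pow_succ, pow_succ]
    exact (displacementIndex_mul_le hVo hVc _ _).trans (Nat.mul_le_mul_right _ ih)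

/-- If `s_V` is multiplicative at `(y, z)`, then `y V z ⊆ V y z V`. -/
theorem mul_mul_mem_doubleCoset {V : Subgroup G} (hVo : IsOpen (V : Set G))
    (hVc : IsCompact (V : Set G)) {y z : G}
    (h : displacementIndex V (y * z) = displacementIndex V y * displacementIndex V z)
    {v : G} (hv : v ∈ V) : ∃ a ∈ V, ∃ b ∈ V, y * v * z = a * (y * z) * b := by
  rw [displacementIndex_mul_eq_relIndex, displacementIndex_eq' V y, displacementIndex_eq V z] at h
  obtain ⟨k, hk, d, hd, hkd⟩ := exists_mul_eq_of_relIndex_eq_mul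
    (relIndex_ne_zero_of_isOpen_of_isCompact (isOpen_conjSubgroup hVo _) hVc)
    (relIndex_ne_zero_of_isOpen_of_isCompact hVo (isCompact_conjSubgroup hVc _)) h _
    (V.inv_mem hv)
  rw [mem_conjSubgroup, inv_inv] at hd
  refine ⟨_, V.inv_mem hd, _, V.inv_mem (mem_conjSubgroup.1 hk.2), ?_⟩
  rw [← inv_inv v, ← hkd]
  group

theorem exists_displacementIndex_le_mul {U W : Subgroup G} (hUo : IsOpen (U : Set G))
    (hUc : IsCompact (U : Set G)) (hWo : IsOpen (W : Set G)) (hWc : IsCompact (W : Set G)) :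
    ∃ C : ℕ, ∀ y : G, displacementIndex W y ≤ C * displacementIndex U y := by
  -- Go from $yWy^{-1}$ to $W$ through $yUy^{-1}$ and $U$; the outer two indices do not depend on
  -- $y$.
  refine ⟨W.relIndex U * U.relIndex W, fun y => ?_⟩
  have hU := isCompact_conjSubgroup hUc y
  have hW := isCompact_conjSubgroup hWc y
  have key {A B : Subgroup G} (hA : IsOpen (A : Set G)) (hB : IsCompact (B : Set G)) :=
    relIndex_ne_zero_of_isOpen_of_isCompact hA hB
  calc displacementIndex W y = W.relIndex (conjSubgroup y W) := displacementIndex_eq _ _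
    _ ≤ W.relIndex U * U.relIndex (conjSubgroup y W) := relIndex_le_mul (key hWo hUc) (key hUo hW)
    _ ≤ W.relIndex U * (U.relIndex (conjSubgroup y U) *
          (conjSubgroup y U).relIndex (conjSubgroup y W)) :=
        Nat.mul_le_mul_left _ (relIndex_le_mul (key hUo hU) (key (isOpen_conjSubgroup hUo y) hW))
    _ = _ := by rw [relIndex_conjSubgroup, displacementIndex_eq]; ring

/-- If $a=s_V(x^n)<b=s_V(x)^n$, then $b^k\le s_W(x^{nk})\le C s_V(x^{nk})\le C a^k$ for every $k$,
which fails for large $k$. -/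
theorem displacementIndex_pow_eq {V W : Subgroup G} (hVo : IsOpen (V : Set G))
    (hVc : IsCompact (V : Set G)) (hWo : IsOpen (W : Set G)) (hWc : IsCompact (W : Set G)) {x : G}
    (hW : ∀ n : ℕ, displacementIndex W (x ^ n) = displacementIndex W x ^ n)
    (hle : displacementIndex V x ≤ displacementIndex W x) (n : ℕ) :
    displacementIndex V (x ^ n) = displacementIndex V x ^ n := by
  refine le_antisymm (displacementIndex_pow_le hVo hVc x n) (not_lt.1 fun hlt => ?_)
  obtain ⟨C, hC⟩ := exists_displacementIndex_le_mul hVo hVc hWo hWc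
  set a := displacementIndex V (x ^ n) with ha
  set b := displacementIndex V x ^ n with hb
  have hapos : 0 < a := displacementIndex_pos V hVo hVc _
  have hbound : ∀ k : ℕ, b ^ k ≤ C * a ^ k := fun k =>
    calc b ^ k ≤ (displacementIndex W x ^ n) ^ k :=
          Nat.pow_le_pow_left (Nat.pow_le_pow_left hle n) k
      _ = displacementIndex W ((x ^ n) ^ k) := by rw [← pow_mul, ← pow_mul, hW]
      _ ≤ C * displacementIndex V ((x ^ n) ^ k) := hC _
      _ ≤ C * a ^ k := Nat.mul_le_mul_left _ (displacementIndex_pow_le hVo hVc _ k)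
  have ha0 : (0 : ℝ) < a := by exact_mod_cast hapos
  have h1 : (1 : ℝ) < b / a := by
    rw [one_lt_div ha0]
    exact_mod_cast hlt
  obtain ⟨k, hk⟩ := pow_unbounded_of_one_lt (C : ℝ) h1
  rw [div_pow, lt_div_iff₀ (pow_pos ha0 k)] at hk
  exact absurd (hbound k) (not_le.2 (by exact_mod_cast hk))

theorem exists_mem_doubleCoset_pow {V : Subgroup G} (hVo : IsOpen (V : Set G))
    (hVc : IsCompact (V : Set G)) {x : G}
    (hV : ∀ n : ℕ, displacementIndex V (x ^ n) = displacementIndex V x ^ n) {y : G}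
    (hy : y ∈ Subsemigroup.closure (insert x (V : Set G))) :
    ∃ n : ℕ, ∃ a ∈ V, ∃ b ∈ V, y = a * x ^ n * b := by
  induction hy using Subsemigroup.closure_induction with
  | mem y hy =>
    rcases hy with rfl | hy
    · exact ⟨1, 1, V.one_mem, 1, V.one_mem, by simp⟩
    · exact ⟨0, y, hy, 1, V.one_mem, by simp⟩
  | mul y z _ _ hy hz =>
    obtain ⟨n, a, ha, b, hb, rfl⟩ := hy
    obtain ⟨m, c, hc, d, hd, rfl⟩ := hz
    obtain ⟨e, he, f, hf, h⟩ := mul_mul_mem_doubleCoset hVo hVc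
      (y := x ^ n) (z := x ^ m) (by rw [← pow_add, hV, hV, hV, pow_add]) (V.mul_mem hb hc)
    refine ⟨n + m, a * e, V.mul_mem ha he, f * d, V.mul_mem hf hd, ?_⟩
    calc a * x ^ n * b * (c * x ^ m * d) = a * (x ^ n * (b * c) * x ^ m) * d := by group
      _ = _ := by rw [h, pow_add]; simp only [mul_assoc]

theorem isMultiplicativeOver_closure {V : Subgroup G} (hVo : IsOpen (V : Set G))
    (hVc : IsCompact (V : Set G)) {x : G}
    (hV : ∀ n : ℕ, displacementIndex V (x ^ n) = displacementIndex V x ^ n) :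
    IsMultiplicativeOver (Subsemigroup.closure (insert x (V : Set G))) V := by
  refine ⟨(Set.subset_insert _ _).trans Subsemigroup.subset_closure, fun y hy z hz => ?_⟩
  obtain ⟨n, a, ha, b, hb, rfl⟩ := exists_mem_doubleCoset_pow hVo hVc hV hy
  obtain ⟨m, c, hc, d, hd, rfl⟩ := exists_mem_doubleCoset_pow hVo hVc hV hz
  obtain ⟨e, he, f, hf, h⟩ := mul_mul_mem_doubleCoset hVo hVc
    (y := x ^ n) (z := x ^ m) (by rw [← pow_add, hV, hV, hV, pow_add]) (V.mul_mem hb hc)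
  have h' : a * x ^ n * b * (c * x ^ m * d) = a * e * x ^ (n + m) * (f * d) := by
    calc a * x ^ n * b * (c * x ^ m * d) = a * (x ^ n * (b * c) * x ^ m) * d := by group
      _ = _ := by rw [h, pow_add]; simp only [mul_assoc]
  rw [h', displacementIndex_mul_of_mem (V.mul_mem ha he) (V.mul_mem hf hd),
    displacementIndex_mul_of_mem ha hb, displacementIndex_mul_of_mem hc hd, hV, hV, hV, pow_add]

/-- $s_V$ is constant on each open coset $gV$. -/
theorem continuous_displacementIndex {V : Subgroup G} (hVo : IsOpen (V : Set G)) :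
    Continuous (displacementIndex V) := by
  refine IsLocallyConstant.continuous ((IsLocallyConstant.iff_eventually_eq _).2 fun g => ?_)
  have hmem : {y : G | g⁻¹ * y ∈ V} ∈ 𝓝 g :=
    (hVo.preimage (continuous_const_mul g⁻¹)).mem_nhds (by simp [V.one_mem])
  filter_upwards [hmem] with y hy
  simpa using displacementIndex_mul_of_mem V.one_mem hy g

theorem not_isCompact_closure {V : Subgroup G} (hVo : IsOpen (V : Set G))
    (hVc : IsCompact (V : Set G)) {x : G}
    (hV : ∀ n : ℕ, displacementIndex V (x ^ n) = displacementIndex V x ^ n)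
    (hx : displacementIndex V x ≠ 1) :
    ¬ IsCompact ((Subsemigroup.closure (insert x (V : Set G)) : Subsemigroup G) : Set G) := by
  intro hS
  obtain ⟨B, hB⟩ := (hS.image (continuous_displacementIndex hVo)).bddAbove
  have hmem : x ∈ Subsemigroup.closure (insert x (V : Set G)) :=
    Subsemigroup.subset_closure (Set.mem_insert _ _)
  have hpow : ∀ n : ℕ, x ^ (n + 1) ∈ Subsemigroup.closure (insert x (V : Set G)) := fun n => by
    induction n with
    | zero => simpa using hmem
    | succ n ih => rw [pow_succ]; exact mul_mem ih hmem
  have h1 : 1 < displacementIndex V x :=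
    lt_of_le_of_ne (displacementIndex_pos V hVo hVc x) (Ne.symm hx)
  have h2 := hB ⟨_, hpow B, rfl⟩
  rw [hV] at h2
  have h3 := Nat.lt_pow_self h1 (n := B + 1)
  omega

end Topological

/-! ### Orbits under conjugation by $x$, tidiness and shadowing. -/

section Orbit

variable {G : Type*} [Group G]

/-- The automorphism `g ↦ xⁿ g x⁻ⁿ`. -/
def conjPow (x : G) (n : ℤ) : G →* G := (MulAut.conj (x ^ n)).toMonoidHom

theorem conjPow_apply (x : G) (n : ℤ) (g : G) : conjPow x n g = x ^ n * g * (x ^ n)⁻¹ := rfl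

@[simp]
theorem conjPow_zero (x g : G) : conjPow x 0 g = g := by simp [conjPow_apply]

theorem conjPow_conjPow (x : G) (m n : ℤ) (g : G) :
    conjPow x m (conjPow x n g) = conjPow x (m + n) g := by
  simp [conjPow_apply, zpow_add, mul_assoc]

@[simp]
theorem conjPow_neg_conjPow (x : G) (n : ℤ) (g : G) : conjPow x (-n) (conjPow x n g) = g := by
  simp [conjPow_conjPow]

@[simp]
theorem conjPow_conjPow_neg (x : G) (n : ℤ) (g : G) : conjPow x n (conjPow x (-n) g) = g := by
  simp [conjPow_conjPow]

theorem conjPow_inv (x : G) (n : ℤ) (g : G) : conjPow x⁻¹ n g = conjPow x (-n) g := by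
  simp [conjPow_apply]

/-- The elements `g` with `xⁿ g x⁻ⁿ ∈ V` for all `n ∈ s`. -/
def orbitCore (x : G) (V : Subgroup G) (s : Set ℤ) : Subgroup G where
  carrier := {g | ∀ n ∈ s, conjPow x n g ∈ V}
  one_mem' n _ := by simp [V.one_mem]
  mul_mem' ha hb n hn := by rw [map_mul]; exact V.mul_mem (ha n hn) (hb n hn)
  inv_mem' ha n hn := by rw [map_inv]; exact V.inv_mem (ha n hn)

theorem mem_orbitCore {x : G} {V : Subgroup G} {s : Set ℤ} {g : G} :
    g ∈ orbitCore x V s ↔ ∀ n ∈ s, conjPow x n g ∈ V := Iff.rfl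

theorem mem_orbitCore_inv {x : G} {V : Subgroup G} {s : Set ℤ} {g : G} :
    g ∈ orbitCore x⁻¹ V s ↔ ∀ n ∈ s, conjPow x (-n) g ∈ V := by
  simp only [mem_orbitCore, conjPow_inv]

/-- The elements `g` with `xⁿ g x⁻ⁿ ∈ V` for all but finitely many integers `n`. -/
def cofiniteCore (x : G) (V : Subgroup G) : Subgroup G where
  carrier := {g | ∃ N : ℕ, ∀ n : ℤ, (N : ℤ) ≤ |n| → conjPow x n g ∈ V}
  one_mem' := ⟨0, fun n _ => by simp [V.one_mem]⟩
  mul_mem' := by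
    rintro a b ⟨M, hM⟩ ⟨N, hN⟩
    refine ⟨max M N, fun n hn => ?_⟩
    rw [map_mul]
    exact V.mul_mem (hM n (by omega)) (hN n (by omega))
  inv_mem' := by
    rintro a ⟨M, hM⟩
    exact ⟨M, fun n hn => by rw [map_inv]; exact V.inv_mem (hM n hn)⟩

theorem mem_cofiniteCore_of_forall {x : G} {V : Subgroup G} {g : G} (M N : ℤ)
    (hM : ∀ n ≤ M, conjPow x n g ∈ V) (hN : ∀ n, N ≤ n → conjPow x n g ∈ V) :
    g ∈ cofiniteCore x V :=
  ⟨max M.natAbs N.natAbs, fun n hn => by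
    rcases le_total 0 n with h | h
    · exact hN n (by rw [abs_of_nonneg h] at hn; omega)
    · exact hM n (by rw [abs_of_nonpos h] at hn; omega)⟩

theorem conjPow_mem_cofiniteCore {x : G} {V : Subgroup G} {g : G} (hg : g ∈ cofiniteCore x V)
    (k : ℤ) : conjPow x k g ∈ cofiniteCore x V := by
  obtain ⟨N, hN⟩ := hg
  refine mem_cofiniteCore_of_forall (-N - k) (N - k) (fun n hn => ?_) fun n hn => ?_
  · rw [conjPow_conjPow]
    exact hN _ (by rw [abs_of_nonpos (by omega)]; omega)
  · rw [conjPow_conjPow]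
    exact hN _ (by rw [abs_of_nonneg (by omega)]; omega)

theorem cofiniteCore_mono {x : G} {V W : Subgroup G} (h : V ≤ W) :
    cofiniteCore x V ≤ cofiniteCore x W :=
  fun _ ⟨N, hN⟩ => ⟨N, fun n hn => h (hN n hn)⟩

/-- `V = V₊ V₋`, where `V₊` and `V₋` consist of the elements whose backward and forward orbits
under conjugation by `x` stay in `V`. -/
def IsTidyAbove (x : G) (V : Subgroup G) : Prop :=
  ∀ v ∈ V, ∃ a ∈ orbitCore x V (Set.Iic 0), ∃ b ∈ orbitCore x V (Set.Ici 0), a * b = v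

/-- Far in the past the orbits of $g$ and $a$ are in $V$, hence so is that of $b$; then $a=gb^{-1}$
is almost contained as well. -/
theorem IsTidyAbove.exists_cofiniteCore {x : G} {V : Subgroup G} (hV : IsTidyAbove x V) {g : G}
    (hg : g ∈ cofiniteCore x V) (hgV : g ∈ V) :
    ∃ a ∈ cofiniteCore x V, a ∈ orbitCore x V (Set.Iic 0) ∧
      ∃ b ∈ cofiniteCore x V, b ∈ orbitCore x V (Set.Ici 0) ∧ a * b = g := by
  obtain ⟨a, ha, b, hb, rfl⟩ := hV g hgV
  obtain ⟨N, hN⟩ := hg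
  have hbL : b ∈ cofiniteCore x V := by
    refine mem_cofiniteCore_of_forall (-N) 0 (fun n hn => ?_) fun n hn => hb n hn
    have h := hN n (by rw [abs_of_nonpos (by omega)]; omega)
    rwa [map_mul, V.mul_mem_cancel_left (ha n (by simp only [Set.mem_Iic]; omega))] at h
  exact ⟨a, (Subgroup.mul_mem_cancel_right _ hbL).1 ⟨N, hN⟩, ha, b, hbL, hb, rfl⟩

/-- Tidiness excludes excursions: an orbit that leaves $W$ does not return. -/
theorem IsTidyAbove.conjPow_mem {x : G} {W : Subgroup G} (hW : IsTidyAbove x W)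
    (hL : cofiniteCore x W ≤ W) {g : G} {m k : ℤ} (hg : g ∈ W) (hm : conjPow x m g ∈ W)
    (hk : 0 ≤ k) (hkm : k ≤ m) : conjPow x k g ∈ W := by
  obtain ⟨a, ha, b, hb, rfl⟩ := hW g hg
  rw [map_mul, W.mul_mem_cancel_right (hb m (by simp only [Set.mem_Ici]; omega))] at hm
  obtain ⟨a', ha', b', hb', hab'⟩ := hW _ hm
  -- The $W_-$ factor $b'$ of $x^m a x^{-m}$ has both ends of its orbit in $W$, so by `hL` its whole
  -- orbit is there.
  have hb'L : b' ∈ cofiniteCore x W := by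
    refine mem_cofiniteCore_of_forall (-m) 0 (fun n hn => ?_) fun n hn => hb' n hn
    have h : conjPow x n (conjPow x m a) ∈ W := by
      rw [conjPow_conjPow]
      exact ha _ (by simp only [Set.mem_Iic]; omega)
    rwa [← hab', map_mul, W.mul_mem_cancel_left (ha' n (by simp only [Set.mem_Iic]; omega))] at h
  have h : conjPow x (k - m) (conjPow x m a) ∈ W := by
    rw [← hab', map_mul]
    exact W.mul_mem (ha' _ (by simp only [Set.mem_Iic]; omega))
      (hL (conjPow_mem_cofiniteCore hb'L _))
  rw [conjPow_conjPow, sub_add_cancel] at h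
  rw [map_mul]
  exact W.mul_mem h (hb k hk)

/-- Equality in the index estimate for $D=x^{-1}Wx$ and $C=x^nWx^{-n}$: absence of excursions gives
$D\cap C\le W$, and $W_+\le C$, $W_-\le D$ give $W=(W\cap C)(W\cap D)$. -/
theorem IsTidyAbove.displacementIndex_pow {x : G} {W : Subgroup G} (hW : IsTidyAbove x W)
    (hL : cofiniteCore x W ≤ W) (n : ℕ) :
    displacementIndex W (x ^ n) = displacementIndex W x ^ n := by
  induction n with
  | zero => simp [displacementIndex_one]
  | succ n ih =>
    have hD : ∀ g, g ∈ conjSubgroup x⁻¹ W ↔ conjPow x 1 g ∈ W := fun g => by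
      simp [mem_conjSubgroup, conjPow_apply]
    have hC : ∀ g, g ∈ conjSubgroup (x ^ n) W ↔ conjPow x (-n) g ∈ W := fun g => by
      simp [mem_conjSubgroup, conjPow_apply]
    rw [pow_succ', displacementIndex_mul_eq_relIndex, relIndex_eq_mul (V := W),
      ← displacementIndex_eq', ← displacementIndex_eq, ih, pow_succ']
    · rintro g ⟨hg1, hg2⟩
      have h := hW.conjPow_mem hL (m := n + 1) (k := n) ((hC g).1 hg2)
        (by rw [conjPow_conjPow]; simpa using (hD g).1 hg1) (by omega) (by omega)
      simpa using h
    · intro g hg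
      obtain ⟨a, ha, b, hb, rfl⟩ := hW g hg
      refine ⟨a, ⟨by simpa using ha 0 (by simp), (hC a).2 (ha _ (by simp))⟩, b,
        (hD b).2 (hb 1 (by simp)), rfl⟩

/-- A shadowing lemma: an orbit segment in `V' L` follows, up to `L`, an orbit segment in `V`. -/
theorem exists_mul_eq_of_mem_orbitCore {x : G} {V V' L W : Subgroup G}
    (hLinv : ∀ n : ℤ, ∀ l ∈ L, conjPow x n l ∈ L)
    (hLV : ∀ l ∈ L, l ∈ V → ∃ a ∈ orbitCore x V (Set.Iic 0), ∃ b ∈ L,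
      b ∈ orbitCore x V (Set.Ici 0) ∧ a * b = l)
    (hV' : ∀ v ∈ V', v ∈ V ∧ conjPow x 1 v ∈ V) (hW : ∀ g ∈ W, ∃ v ∈ V', ∃ l ∈ L, v * l = g)
    (M : ℕ) : ∀ g ∈ orbitCore x W (Set.Icc 0 M),
      ∃ u ∈ orbitCore x V (Set.Icc 0 M), ∃ l ∈ L, u * l = g := by
  induction M with
  | zero =>
    intro g hg
    obtain ⟨v, hv, l, hl, rfl⟩ := hW g (by simpa using hg 0 (by simp))
    refine ⟨v, fun n hn => ?_, l, hl, rfl⟩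
    obtain rfl : n = 0 := by simpa using hn
    simpa using (hV' v hv).1
  | succ M ih =>
    intro g hg
    obtain ⟨u, hu, l, hl, hul⟩ := ih (conjPow x 1 g) fun n hn => by
      rw [conjPow_conjPow]
      exact hg _ (by simp only [Set.mem_Icc] at hn ⊢; push_cast; omega)
    obtain ⟨v, hv, l', hl', hvl'⟩ := hW g (by simpa using hg 0 (by simp; omega))
    -- `c` measures how far the two approximations of `g` are apart
    have hc : (conjPow x 1 v)⁻¹ * u = conjPow x 1 l' * l⁻¹ := by
      rw [inv_mul_eq_iff_eq_mul, ← mul_assoc, ← map_mul, hvl', ← hul]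
      group
    obtain ⟨a, ha, b, hbL, hb, hab⟩ := hLV ((conjPow x 1 v)⁻¹ * u)
      (by rw [hc]; exact L.mul_mem (hLinv 1 _ hl') (L.inv_mem hl))
      (V.mul_mem (V.inv_mem (hV' v hv).2) (by simpa using hu 0 (by simp)))
    -- Splitting $c=ab$ glues the approximations: after one step the new orbit is that of $ub^{-1}$,
    -- with $b$ staying in $V$ forwards; at time $0$ the correction of $v$ is harmless because $a$
    -- stays in $V$ backwards.
    refine ⟨v * conjPow x (-1) a, fun n hn => ?_, conjPow x (-1) (b * l),
      hLinv _ _ (L.mul_mem hbL hl), ?_⟩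
    · rcases eq_or_lt_of_le hn.1 with rfl | hn0
      · rw [conjPow_zero]
        exact V.mul_mem (hV' v hv).1 (ha (-1) (by simp))
      · have h : conjPow x 1 (v * conjPow x (-1) a) = u * b⁻¹ := by
          rw [map_mul, conjPow_conjPow_neg, eq_mul_inv_iff_mul_eq, mul_assoc, hab,
            mul_inv_cancel_left]
        have hn' : n = (n - 1) + 1 := by omega
        rw [hn', ← conjPow_conjPow, h, map_mul, map_inv]
        exact V.mul_mem (hu _ (by simp only [Set.mem_Icc] at hn ⊢; push_cast at hn; omega))
          (V.inv_mem (hb _ (by simp only [Set.mem_Ici]; omega)))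
    · rw [mul_assoc, ← map_mul, ← mul_assoc, hab, mul_assoc, hul, map_mul, map_inv,
        conjPow_neg_conjPow, conjPow_neg_conjPow, mul_inv_cancel_left]

end Orbit

/-! ### Compactness of orbit groups and tidiness above. -/

section Topological

variable {G : Type*} [Group G] [TopologicalSpace G] [IsTopologicalGroup G]

theorem continuous_conjPow (x : G) (n : ℤ) : Continuous (conjPow x n) := by
  show Continuous fun g => x ^ n * g * (x ^ n)⁻¹
  fun_prop

theorem isClosed_orbitCore {V : Subgroup G} (hV : IsClosed (V : Set G)) (x : G) (s : Set ℤ) :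
    IsClosed (orbitCore x V s : Set G) := by
  have h : (orbitCore x V s : Set G) = ⋂ n ∈ s, conjPow x n ⁻¹' V := by
    ext g
    simp [mem_orbitCore]
  rw [h]
  exact isClosed_biInter fun n _ => hV.preimage (continuous_conjPow x n)

theorem isOpen_orbitCore {V : Subgroup G} (hV : IsOpen (V : Set G)) (x : G) {s : Set ℤ}
    (hs : s.Finite) : IsOpen (orbitCore x V s : Set G) := by
  have h : (orbitCore x V s : Set G) = ⋂ n ∈ s, conjPow x n ⁻¹' V := by
    ext g
    simp [mem_orbitCore]
  rw [h]
  exact hs.isOpen_biInter fun n _ => hV.preimage (continuous_conjPow x n)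

theorem isCompact_orbitCore {V : Subgroup G} (hVo : IsOpen (V : Set G))
    (hVc : IsCompact (V : Set G)) (x : G) {s : Set ℤ} (hs : s.Nonempty) :
    IsCompact (orbitCore x V s : Set G) := by
  obtain ⟨n, hn⟩ := hs
  refine (hVc.image (continuous_conjPow x (-n))).of_isClosed_subset
    (isClosed_orbitCore (V.isClosed_of_isOpen hVo) x s) fun g hg => ?_
  exact ⟨conjPow x n g, hg n hn, by simp⟩

theorem exists_forall_inv_mul_mem {A : Set G} (hA : IsCompact A) {C : ℕ → Set G}
    (hC : ∀ n, IsClosed (C n)) (hanti : Antitone C) {g : G}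
    (h : ∀ n, ∃ a ∈ A, a⁻¹ * g ∈ C n) : ∃ a ∈ A, ∀ n, a⁻¹ * g ∈ C n := by
  obtain ⟨a, ha, ha'⟩ := hA.inter_iInter_nonempty (fun n => {a | a⁻¹ * g ∈ C n})
    (fun n => (hC n).preimage (by fun_prop)) fun u => by
      obtain ⟨a, ha, hag⟩ := h (u.sup id)
      exact ⟨a, ha, Set.mem_iInter₂.2 fun i hi => hanti (Finset.le_sup (f := id) hi) hag⟩
  exact ⟨a, ha, fun n => Set.mem_iInter.1 ha' n⟩

theorem exists_isTidyAbove [T2Space G] {V : Subgroup G} (hVo : IsOpen (V : Set G))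
    (hVc : IsCompact (V : Set G)) (x : G) :
    ∃ n : ℕ, IsTidyAbove x (orbitCore x V (Set.Icc (-n) 0)) := by
  have hVcl := V.isClosed_of_isOpen hVo
  -- The finite windows are compact and decrease to the infinite one, so one of them lies in its
  -- open neighbourhood.
  obtain ⟨n, hn⟩ : ∃ n : ℕ, (orbitCore x V (Set.Icc (-n - 1) (-1)) : Set G) ⊆
      (orbitCore x V (Set.Iic (-1)) : Set G) * (V : Set G) := by
    refine exists_subset_nhds_of_isCompact (fun m n => ⟨max m n, ?_, ?_⟩)
      (fun n => isCompact_orbitCore hVo hVc x ⟨-1, by simp⟩) fun g hg => ?_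
    · exact fun g hg k hk => hg k (by simp only [Set.mem_Icc] at hk ⊢; push_cast; omega)
    · exact fun g hg k hk => hg k (by simp only [Set.mem_Icc] at hk ⊢; push_cast; omega)
    · refine (hVo.mul_left).mem_nhds ⟨g, fun k hk => ?_, 1, V.one_mem, mul_one g⟩
      exact Set.mem_iInter.1 hg k.natAbs k (by simp only [Set.mem_Iic, Set.mem_Icc] at hk ⊢; omega)
  refine ⟨n, ?_⟩
  -- Each use of `hn` removes an element of $V_+$ and lengthens by one the time that the remainder
  -- stays in $V$; compactness of $V_+$ then allows $M\to\infty$.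
  have step : ∀ M : ℕ, ∀ g ∈ orbitCore x V (Set.Icc (-n) 0),
      ∃ a ∈ orbitCore x V (Set.Iic 0), a⁻¹ * g ∈ orbitCore x V (Set.Icc (-n) M) := by
    intro M
    induction M with
    | zero => exact fun g hg => ⟨1, one_mem _, by simpa using hg⟩
    | succ M ih =>
      intro g hg
      obtain ⟨a, ha, b, hb, hab⟩ := hn (show conjPow x 1 g ∈ _ from fun k hk => by
        rw [conjPow_conjPow]
        exact hg _ (by simp only [Set.mem_Icc] at hk ⊢; omega))
      have ha' : conjPow x (-1) a ∈ orbitCore x V (Set.Iic 0) := fun k hk => by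
        rw [conjPow_conjPow]
        exact ha _ (by simp only [Set.mem_Iic] at hk ⊢; omega)
      have hb' : conjPow x 1 ((conjPow x (-1) a)⁻¹ * g) = b := by
        rw [map_mul, map_inv, conjPow_conjPow_neg, ← hab, inv_mul_cancel_left]
      have hwin : (conjPow x (-1) a)⁻¹ * g ∈ orbitCore x V (Set.Icc (-n) 0) :=
        mul_mem (inv_mem fun k hk => ha' k hk.2) hg
      obtain ⟨c, hc, hd⟩ := ih b fun k hk => by
        rcases eq_or_lt_of_le hk.2 with rfl | hk0
        · simpa using hb
        · rw [← hb', conjPow_conjPow]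
          exact hwin _ (by simp only [Set.mem_Icc] at hk ⊢; omega)
      have hc' : conjPow x (-1) c ∈ orbitCore x V (Set.Iic 0) := fun k hk => by
        rw [conjPow_conjPow]
        exact hc _ (by simp only [Set.mem_Iic] at hk ⊢; omega)
      refine ⟨conjPow x (-1) a * conjPow x (-1) c, mul_mem ha' hc', fun k hk => ?_⟩
      rw [mul_inv_rev, mul_assoc]
      rcases le_or_gt k 0 with hk0 | hk0
      · have hcwin : conjPow x (-1) c ∈ orbitCore x V (Set.Icc (-n) 0) := fun k hk => hc' k hk.2
        exact mul_mem (inv_mem hcwin) hwin k ⟨hk.1, hk0⟩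
      · have h := hd (k - 1) (by simp only [Set.mem_Icc] at hk ⊢; push_cast at hk; omega)
        rw [← hb', ← conjPow_conjPow_neg x 1 c, ← map_inv, ← map_mul, conjPow_conjPow,
          sub_add_cancel] at h
        exact h
  intro g hg
  obtain ⟨a, ha, hag⟩ := exists_forall_inv_mul_mem
    (isCompact_orbitCore hVo hVc x (s := Set.Iic 0) ⟨0, by simp⟩)
    (C := fun M : ℕ => (orbitCore x V (Set.Icc (-n) M) : Set G))
    (fun M => isClosed_orbitCore hVcl x _)
    (fun M M' hM g hg k hk => hg k ⟨hk.1, hk.2.trans (by exact_mod_cast hM)⟩) (fun M => step M g hg)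
  refine ⟨a, fun k hk j hj => ?_, a⁻¹ * g, fun k hk j hj => ?_, mul_inv_cancel_left _ _⟩
  · rw [conjPow_conjPow]
    exact ha _ (by simp only [Set.mem_Iic, Set.mem_Icc] at hk hj ⊢; omega)
  · rw [conjPow_conjPow]
    exact hag (j + k).natAbs _ (by simp only [Set.mem_Ici, Set.mem_Icc] at hk hj ⊢; omega)

end Topological

/-! ### The compact invariant group $L$ and the construction of a tidy subgroup. -/

section Limit

variable {G : Type*} [Group G] [TopologicalSpace G] [IsTopologicalGroup G]

theorem exists_mem_mul_of_mem_closure {A : Set G} {V : Subgroup G} (hV : IsOpen (V : Set G)) {g : G}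
    (hg : g ∈ closure A) : ∃ f ∈ A, f⁻¹ * g ∈ V := by
  have ho : {f : G | f⁻¹ * g ∈ V} ∈ 𝓝 g :=
    (hV.preimage (f := fun f : G => f⁻¹ * g) (by fun_prop)).mem_nhds (by simp [V.one_mem])
  obtain ⟨f, hf, hfA⟩ := mem_closure_iff_nhds.1 hg _ ho
  exact ⟨f, hfA, hf⟩

/-- The point is that $N$ is independent of $h$ and $k$; this bounds the cofinite core by a product
of two compact sets. -/
theorem exists_nat_forall_conjPow_mem {V : Subgroup G} (hVo : IsOpen (V : Set G))
    (hVc : IsCompact (V : Set G)) (x : G) :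
    ∃ N : ℕ, ∀ k : ℕ, ∀ h ∈ cofiniteCore x V, conjPow x k h ∈ orbitCore x V (Set.Ici 0) →
      ∃ f ∈ cofiniteCore x V, f ∈ orbitCore x V (Set.Iic (-N)) ∧
        f⁻¹ * h ∈ orbitCore x V (Set.Ici 0) := by
  set A : Set G := {h | h ∈ cofiniteCore x V ∧ h ∈ orbitCore x V (Set.Ici 1)} with hA
  obtain ⟨N, hN⟩ : ∃ N : ℕ, closure A ⊆
      (A ∩ orbitCore x V (Set.Iic (-N)) : Set G) * (V : Set G) := by
    have hAc : IsCompact (closure A) := by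
      have hK := isCompact_orbitCore hVo hVc x (s := Set.Ici 1) ⟨1, by simp⟩
      exact hK.of_isClosed_subset isClosed_closure (closure_minimal (fun g hg => hg.2)
        (isClosed_orbitCore (V.isClosed_of_isOpen hVo) x _))
    refine hAc.elim_directed_cover
      (fun N : ℕ => (A ∩ orbitCore x V (Set.Iic (-N)) : Set G) * (V : Set G))
      (fun N => hVo.mul_left) (fun g hg => ?_) fun M N => ⟨max M N, ?_, ?_⟩
    · obtain ⟨f, hf, hfg⟩ := exists_mem_mul_of_mem_closure hVo hg
      obtain ⟨N, hN⟩ := hf.1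
      refine Set.mem_iUnion.2 ⟨N, f, ⟨hf, fun n hn => hN n ?_⟩, _, hfg, mul_inv_cancel_left _ _⟩
      simp only [Set.mem_Iic] at hn
      rw [abs_of_nonpos (by omega)]
      omega
    · exact Set.mul_subset_mul_right fun g hg => ⟨hg.1, fun n hn =>
        hg.2 n (by simp only [Set.mem_Iic] at hn ⊢; push_cast at hn; omega)⟩
    · exact Set.mul_subset_mul_right fun g hg => ⟨hg.1, fun n hn =>
        hg.2 n (by simp only [Set.mem_Iic] at hn ⊢; push_cast at hn; omega)⟩
  refine ⟨N, fun k => ?_⟩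
  induction k with
  | zero =>
    intro h hh hk
    exact ⟨1, one_mem _, one_mem _, by simpa using hk⟩
  | succ k ih =>
    intro h hh hk
    have hh' := conjPow_mem_cofiniteCore hh k
    obtain ⟨f, ⟨⟨hfL, hf1⟩, hfN⟩, w, hw, hfw⟩ := hN (subset_closure
      (show conjPow x k h ∈ A from ⟨hh', fun n hn => by
        have := hk (n - 1) (by simp only [Set.mem_Ici] at hn ⊢; omega)
        rwa [conjPow_conjPow, show n - 1 + ((k + 1 : ℕ) : ℤ) = n + k by push_cast; ring,
          ← conjPow_conjPow] at this⟩))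
    simp only at hfw
    have hwV : w ∈ orbitCore x V (Set.Ici 0) := fun n hn => by
      rcases eq_or_lt_of_le (Set.mem_Ici.1 hn) with rfl | hn0
      · simpa using hw
      · have h1 := hk (n - 1) (by simp only [Set.mem_Ici]; omega)
        rw [conjPow_conjPow, show n - 1 + ((k + 1 : ℕ) : ℤ) = n + k by push_cast; ring,
          ← conjPow_conjPow, ← hfw, map_mul] at h1
        rwa [ V.mul_mem_cancel_left (hf1 n (by simp only [Set.mem_Ici]; omega))] at h1
    have hwL : w ∈ cofiniteCore x V :=
      (Subgroup.mul_mem_cancel_left _ hfL).1 (by rw [hfw]; exact hh')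
    obtain ⟨f', hf'L, hf'N, hw'⟩ := ih (conjPow x (-k) w) (conjPow_mem_cofiniteCore hwL _)
      (by rwa [conjPow_conjPow_neg])
    -- Pulling $f$ back by $x^{-k}$ only strengthens its condition on times $\le -N$, so $N$ does
    -- not grow in the induction.
    refine ⟨conjPow x (-k) f * f', mul_mem (conjPow_mem_cofiniteCore hfL _) hf'L,
      mul_mem (fun n hn => ?_) hf'N, ?_⟩
    · rw [conjPow_conjPow]
      exact hfN _ (by simp only [Set.mem_Iic] at hn ⊢; omega)
    · have hh2 : h = conjPow x (-k) f * conjPow x (-k) w := by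
        rw [← map_mul, hfw, conjPow_neg_conjPow]
      rw [hh2, mul_inv_rev, mul_assoc, inv_mul_cancel_left]
      exact hw'

/-- The closure of the group of elements whose orbit is almost contained in `V`. -/
def limitCore (x : G) (V : Subgroup G) : Subgroup G := (cofiniteCore x V).topologicalClosure

theorem cofiniteCore_le_limitCore (x : G) (V : Subgroup G) : cofiniteCore x V ≤ limitCore x V :=
  Subgroup.le_topologicalClosure _

theorem conjPow_mem_limitCore {x : G} {V : Subgroup G} (k : ℤ) {g : G} (hg : g ∈ limitCore x V) :
    conjPow x k g ∈ limitCore x V :=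
  map_mem_closure (continuous_conjPow x k) hg fun _ h => conjPow_mem_cofiniteCore h k

theorem isCompact_limitCore [T2Space G] {V : Subgroup G} (hVo : IsOpen (V : Set G))
    (hVc : IsCompact (V : Set G)) (x : G) : IsCompact (limitCore x V : Set G) := by
  obtain ⟨N, hN⟩ := exists_nat_forall_conjPow_mem hVo hVc x
  have hK : IsCompact ((orbitCore x V (Set.Iic (-N)) : Set G) * (orbitCore x V (Set.Ici 0) : Set G)) :=
    (isCompact_orbitCore hVo hVc x ⟨-N, by simp⟩).mul (isCompact_orbitCore hVo hVc x ⟨0, by simp⟩)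
  refine hK.of_isClosed_subset isClosed_closure (closure_minimal (fun g hg => ?_) hK.isClosed)
  obtain ⟨k, hk⟩ := id hg
  obtain ⟨f, -, hf, hfg⟩ := hN k g hg fun n hn => by
    rw [conjPow_conjPow]
    simp only [Set.mem_Ici] at hn
    exact hk _ (by rw [abs_of_nonneg (by omega)]; omega)
  exact ⟨f, hf, _, hfg, mul_inv_cancel_left _ _⟩

/-- The splitting passes from the cofinite core to its closure because the product of the two
compact factor sets is closed. -/
theorem exists_mul_eq_of_mem_limitCore [T2Space G] {x : G} {V : Subgroup G}
    (hVo : IsOpen (V : Set G)) (hVc : IsCompact (V : Set G)) (hV : IsTidyAbove x V) {l : G}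
    (hl : l ∈ limitCore x V) (hlV : l ∈ V) :
    ∃ a ∈ limitCore x V, a ∈ orbitCore x V (Set.Iic 0) ∧
      ∃ b ∈ limitCore x V, b ∈ orbitCore x V (Set.Ici 0) ∧ a * b = l := by
  have hL := isCompact_limitCore hVo hVc x
  have hcl := fun s => isClosed_orbitCore (V.isClosed_of_isOpen hVo) x s
  have hK : IsClosed (((limitCore x V : Set G) ∩ orbitCore x V (Set.Iic 0)) *
      ((limitCore x V : Set G) ∩ orbitCore x V (Set.Ici 0))) :=
    ((hL.inter_right (hcl _)).mul (hL.inter_right (hcl _))).isClosed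
  have hmem : l ∈ closure ((cofiniteCore x V : Set G) ∩ V) := by
    rw [Set.inter_comm]
    exact hVo.inter_closure ⟨hlV, hl⟩
  obtain ⟨a, ha, b, hb, hab⟩ := closure_minimal (fun g hg => by
    obtain ⟨a, haL, ha, b, hbL, hb, hab⟩ := hV.exists_cofiniteCore hg.1 hg.2
    exact ⟨a, ⟨cofiniteCore_le_limitCore x V haL, ha⟩, b,
      ⟨cofiniteCore_le_limitCore x V hbL, hb⟩, hab⟩) hK hmem
  exact ⟨a, ha.1, ha.2, b, hb.1, hb.2, hab⟩

theorem cofiniteCore_le_limitCore_of_forall [T2Space G] {x : G} {V V' W : Subgroup G}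
    (hVo : IsOpen (V : Set G)) (hVc : IsCompact (V : Set G)) (hV : IsTidyAbove x V)
    (hV' : ∀ v ∈ V', v ∈ V ∧ conjPow x 1 v ∈ V ∧ conjPow x (-1) v ∈ V)
    (hW : ∀ g ∈ W, ∃ v ∈ V', ∃ l ∈ limitCore x V, v * l = g) :
    cofiniteCore x W ≤ limitCore x V := by
  have hL := isCompact_limitCore hVo hVc x
  have hcl := V.isClosed_of_isOpen hVo
  -- one-sided shadowing for an arbitrary element, in the limit of infinite length
  have limit : ∀ y : G, (∀ M : ℕ, ∀ g ∈ orbitCore y W (Set.Icc 0 M),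
      ∃ u ∈ orbitCore y V (Set.Icc 0 M), ∃ l ∈ limitCore x V, u * l = g) →
      ∀ g ∈ orbitCore y W (Set.Ici 0),
        ∃ u ∈ orbitCore y V (Set.Ici 0), ∃ l ∈ limitCore x V, u * l = g := by
    intro y hy g hg
    obtain ⟨l, hl, hlg⟩ := exists_forall_inv_mul_mem hL (g := g⁻¹)
      (C := fun M : ℕ => (orbitCore y V (Set.Icc 0 M) : Set G))
      (fun M => isClosed_orbitCore hcl y _)
      (fun M M' hM g hg k hk => hg k ⟨hk.1, hk.2.trans (by exact_mod_cast hM)⟩) fun M => by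
        obtain ⟨u, hu, l, hl, rfl⟩ := hy M g fun n hn => hg n hn.1
        exact ⟨l⁻¹, inv_mem hl, by simpa using hu⟩
    refine ⟨g * l, fun n hn => ?_, l⁻¹, inv_mem hl, by simp⟩
    have h := inv_mem (hlg n.natAbs)
    rw [mul_inv_rev, inv_inv, inv_inv] at h
    exact h n (by simp only [Set.mem_Ici, Set.mem_Icc] at hn ⊢; omega)
  have fwd := limit x (exists_mul_eq_of_mem_orbitCore (V' := V')
    (fun n l hl => conjPow_mem_limitCore n hl)
    (fun l hl hlV => by
      obtain ⟨a, -, ha, b, hb⟩ := exists_mul_eq_of_mem_limitCore hVo hVc hV hl hlV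
      exact ⟨a, ha, b, hb⟩)
    (fun v hv => ⟨(hV' v hv).1, (hV' v hv).2.1⟩) hW)
  have bwd := limit x⁻¹ (exists_mul_eq_of_mem_orbitCore (V' := V')
    (fun n l hl => by rw [conjPow_inv]; exact conjPow_mem_limitCore _ hl)
    (fun l hl hlV => by
      -- Replacing $x$ by $x^{-1}$ swaps the two factors; splitting $l^{-1}$ and inverting restores
      -- their order.
      obtain ⟨a, haL, ha, b, hbL, hb, hab⟩ :=
        exists_mul_eq_of_mem_limitCore hVo hVc hV (inv_mem hl) (inv_mem hlV)
      refine ⟨b⁻¹, inv_mem (mem_orbitCore_inv.2 fun n hn => hb _ ?_), a⁻¹, inv_mem haL,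
        inv_mem (mem_orbitCore_inv.2 fun n hn => ha _ ?_), ?_⟩
      · simp only [Set.mem_Iic, Set.mem_Ici] at hn ⊢; omega
      · simp only [Set.mem_Iic, Set.mem_Ici] at hn ⊢; omega
      · rw [← mul_inv_rev, hab, inv_inv])
    (fun v hv => ⟨(hV' v hv).1, by rw [conjPow_inv]; exact (hV' v hv).2.2⟩) hW)
  rintro g ⟨N, hN⟩
  obtain ⟨b, hb, l, hl, hbl⟩ := fwd (conjPow x N g) fun n hn => by
    rw [conjPow_conjPow]
    simp only [Set.mem_Ici] at hn
    exact hN _ (by rw [abs_of_nonneg (by omega)]; omega)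
  obtain ⟨a, ha, m, hm, ham⟩ := bwd (conjPow x (-N) g) (mem_orbitCore_inv.2 fun n hn => by
    rw [conjPow_conjPow]
    simp only [Set.mem_Ici] at hn
    exact hN _ (by rw [abs_of_nonpos (by omega)]; omega))
  rw [mem_orbitCore_inv] at ha
  have hb' : conjPow x (-N) b * conjPow x (-N) l = g := by
    rw [← map_mul, hbl, conjPow_neg_conjPow]
  have ha' : conjPow x N a * conjPow x N m = g := by
    rw [← map_mul, ham, conjPow_conjPow_neg]
  have hbV : ∀ n : ℤ, N ≤ n → conjPow x n (conjPow x (-N) b) ∈ V := fun n hn => by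
    rw [conjPow_conjPow]
    exact hb _ (by simp only [Set.mem_Ici]; omega)
  have haV : ∀ n : ℤ, n ≤ -N → conjPow x n (conjPow x N a) ∈ V := fun n hn => by
    rw [conjPow_conjPow, ← neg_neg (n + N)]
    exact ha _ (by simp only [Set.mem_Ici]; omega)
  have hlL := conjPow_mem_limitCore (-N) hl
  have hmL := conjPow_mem_limitCore N hm
  generalize conjPow x (-N) b = b at *
  generalize conjPow x N a = a at *
  generalize conjPow x (-N) l = l at *
  generalize conjPow x N m = m at *
  -- Now $g=am=bl$, with $a$ in $V$ in the far past and $b$ in the far future. Writing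
  -- $a^{-1}b=ml^{-1}=fpq$ gives $afp=bq^{-1}$: the left side controls the past, the right side the
  -- future, so this element is in the cofinite core and $a\in L$.
  obtain ⟨f, hf, hfV⟩ := exists_mem_mul_of_mem_closure hVo (mul_mem hmL (inv_mem hlL))
  obtain ⟨N', hN'⟩ := id hf
  obtain ⟨p, hpL, hp, q, hqL, hq, hpq⟩ := exists_mul_eq_of_mem_limitCore hVo hVc hV
    (mul_mem (inv_mem (cofiniteCore_le_limitCore x V hf)) (mul_mem hmL (inv_mem hlL))) hfV
  have hkey : a * f * p = b * q⁻¹ := by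
    rw [eq_mul_inv_iff_mul_eq, mul_assoc, hpq, mul_assoc, mul_inv_cancel_left, ← mul_assoc, ha',
      ← hb', mul_inv_cancel_right]
  have hmem : a * f * p ∈ cofiniteCore x V := by
    refine mem_cofiniteCore_of_forall (-max N N') N (fun n hn => ?_) fun n hn => ?_
    · rw [map_mul, map_mul]
      refine mul_mem (mul_mem (haV n (by omega)) (hN' n ?_)) (hp n ?_)
      · rw [abs_of_nonpos (by omega)]; omega
      · simp only [Set.mem_Iic]; omega
    · rw [hkey, map_mul, map_inv]
      exact mul_mem (hbV n hn) (inv_mem (hq n (by simp only [Set.mem_Ici]; omega)))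
  have hafp := cofiniteCore_le_limitCore x V hmem
  rw [Subgroup.mul_mem_cancel_right _ hpL,
    Subgroup.mul_mem_cancel_right _ (cofiniteCore_le_limitCore x V hf)] at hafp
  rw [← ha']
  exact mul_mem hafp hmL

/-- The intersection of all $L$-conjugates of $U$ is open, by compactness of $L$. -/
theorem exists_isOpen_le_normalized {L U : Subgroup G} (hL : IsCompact (L : Set G))
    (hU : IsOpen (U : Set G)) : ∃ V : Subgroup G, IsOpen (V : Set G) ∧ V ≤ U ∧
      ∀ l ∈ L, ∀ v ∈ V, l * v * l⁻¹ ∈ V := by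
  refine ⟨⨅ l : L, U.comap (MulAut.conj (l : G)).toMonoidHom, ?_, fun v hv => ?_, fun l hl v hv => ?_⟩
  · refine Subgroup.isOpen_of_mem_nhds _ (g := 1) ?_
    have h := hL.eventually_forall_of_forall_eventually (x₀ := (1 : G))
      (P := fun g l => l * g * l⁻¹ ∈ U) fun l _ => by
        have hc : Continuous fun z : G × G => z.2 * z.1 * z.2⁻¹ := by fun_prop
        exact (hU.preimage hc).mem_nhds (by simp [U.one_mem])
    filter_upwards [h] with g hg
    simpa [Subgroup.mem_iInf] using hg
  · simpa using Subgroup.mem_iInf.1 hv 1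
  · refine Subgroup.mem_iInf.2 fun k => ?_
    have h := Subgroup.mem_iInf.1 hv (k * ⟨l, hl⟩)
    simpa [mul_assoc] using h

/-- Every compact open subgroup gives rise to a tidy one. -/
theorem exists_isTidyAbove_cofiniteCore_le [T2Space G] {V₀ : Subgroup G} (hVo : IsOpen (V₀ : Set G))
    (hVc : IsCompact (V₀ : Set G)) (x : G) :
    ∃ W : Subgroup G, IsOpen (W : Set G) ∧ IsCompact (W : Set G) ∧ IsTidyAbove x W ∧
      cofiniteCore x W ≤ W := by
  obtain ⟨n, hV⟩ := exists_isTidyAbove hVo hVc x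
  have hVo' := isOpen_orbitCore hVo x (Set.finite_Icc (-(n : ℤ)) 0)
  have hVc' := isCompact_orbitCore hVo hVc x (s := Set.Icc (-(n : ℤ)) 0) ⟨0, by simp⟩
  generalize orbitCore x V₀ (Set.Icc (-(n : ℤ)) 0) = V at *
  have hL := isCompact_limitCore hVo' hVc' x
  obtain ⟨V', hV'o, hV'le, hV'n⟩ := exists_isOpen_le_normalized hL
    (isOpen_orbitCore hVo' x (Set.finite_Icc (-1 : ℤ) 1))
  have hV'c : IsCompact (V' : Set G) :=
    (isCompact_orbitCore hVo' hVc' x (s := Set.Icc (-1) 1) ⟨0, by simp⟩).of_isClosed_subset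
      (V'.isClosed_of_isOpen hV'o) hV'le
  let W : Subgroup G :=
    { carrier := (V' : Set G) * (limitCore x V : Set G)
      one_mem' := ⟨1, one_mem _, 1, one_mem _, mul_one 1⟩
      mul_mem' := by
        rintro _ _ ⟨v, hv, l, hl, rfl⟩ ⟨w, hw, m, hm, rfl⟩
        exact ⟨v * (l * w * l⁻¹), mul_mem hv (hV'n l hl w hw), l * m, mul_mem hl hm, by
          simp [mul_assoc]⟩
      inv_mem' := by
        rintro _ ⟨v, hv, l, hl, rfl⟩
        exact ⟨l⁻¹ * v⁻¹ * l⁻¹⁻¹, hV'n _ (inv_mem hl) _ (inv_mem hv), l⁻¹, inv_mem hl, by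
          simp [mul_assoc]⟩ }
  have hWo : IsOpen (W : Set G) := hV'o.mul_right
  have hWc : IsCompact (W : Set G) := hV'c.mul hL
  have hLW : limitCore x V ≤ W := fun l hl => ⟨1, one_mem _, l, hl, one_mul l⟩
  have hcof : cofiniteCore x W ≤ limitCore x V := by
    refine cofiniteCore_le_limitCore_of_forall hVo' hVc' hV (fun v hv => ?_) fun g hg => hg
    exact ⟨by simpa using hV'le hv 0 (by simp), hV'le hv 1 (by simp), hV'le hv (-1) (by simp)⟩
  -- $V'L$ need not be tidy above. Cutting it down again loses nothing: $L$ is $x$-invariant and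
  -- lies in `W`, hence in every finite intersection of its conjugates by powers of $x$.
  obtain ⟨m, hW⟩ := exists_isTidyAbove hWo hWc x
  refine ⟨_, isOpen_orbitCore hWo x (Set.finite_Icc _ _),
    isCompact_orbitCore hWo hWc x ⟨0, by simp⟩, hW, fun g hg k _ => ?_⟩
  refine hLW (conjPow_mem_limitCore k (hcof (cofiniteCore_mono (fun h hh => ?_) hg)))
  simpa using hh 0 (by simp)

end Limit

end TDLCGroup

theorem mainTheorem5 {G : Type*} [Group G] [TopologicalSpace G] [IsTopologicalGroup G]
    [LocallyCompactSpace G] [TotallyDisconnectedSpace G]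
    (x : G) (V : Subgroup G) (hV : TDLCGroup.IsMinimizing V x) :
    TDLCGroup.IsMultiplicativeOver (Subsemigroup.closure (insert x (V : Set G))) V ∧
      (TDLCGroup.scale x ≠ 1 →
        ¬ IsCompact ((Subsemigroup.closure (insert x (V : Set G)) : Subsemigroup G) : Set G)) := by
  obtain ⟨hVo, hVc, hVx⟩ := hV
  obtain ⟨W, hWo, hWc, hW, hWcof⟩ := TDLCGroup.exists_isTidyAbove_cofiniteCore_le hVo hVc x
  -- Minimality enters the power law only as $s_V(x)\le s_W(x)$.
  have hpow := TDLCGroup.displacementIndex_pow_eq hVo hVc hWo hWc (hW.displacementIndex_pow hWcof)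
    (hVx.trans_le (Nat.sInf_le ⟨W, hWo, hWc, rfl⟩))
  exact ⟨TDLCGroup.isMultiplicativeOver_closure hVo hVc hpow, fun hx =>
    TDLCGroup.not_isCompact_closure hVo hVc hpow (hVx ▸ hx)⟩
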